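/- Fix a partial computable machine $U$ taking an input string $y$ and a program string $P$ that is universal (every partial computable function on binary strings is $y\mapsto U(y,P)$ for some $P$) and additively optimal (for every partial computable $V$ there is a constant $c$ such that $V(y,P)=x$ implies $U(y,Q)=x$ for some $Q$ of length at most $l(P)+c$). Let $C(x)$ be the least length $l(P)$ of a program $P$ with $U(\epsilon,P)=x$, where $\epsilon$ is the empty string, and let $C(n)$ be the complexity of the $n$-th binary string in length-lexicographic order. For a real $\alpha$ let $\alpha_n$ be the string of the first $n$ binary digits of (the fractional part of) $\alpha$. A real $\alpha$ is left c.e. if it is the limit of a computable nondecreasing sequence of rationals; a program for $\alpha$ is a $P$ such that, for every $s$, $U$ with program $P$ on input $s$ outputs (a code of) the $s$-th term of some such sequence. A real is computable if its sequence of binary digits is computable, and Turing-complete if this sequence computes the halting problem. Then there is a computable function $D:\mathbb N\to\mathbb N$ such that for every non-computable, Turing-incomplete left c.e. real $\alpha$: 1. $C(\alpha_n)-C(n)$ is unbounded: for every $k$ there is an $n$ with $C(\alpha_n)>C(n)+k$; 2. there is a constant $d$, computable from the length of a program for $\alpha$, such that $C(\alpha_n)<C(n)+d$ for infinitely many $n$: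 namely, $\alpha$ has a program, and for every program $P_\alpha$ for $\alpha$ one may take $d=D(l(P_\alpha))$. -/

import Mathlib

namespace LeftCE

/-- Binary strings. -/
abbrev BinStr : Type := List Bool

/-- The standard bijection between natural numbers and binary strings: write `n + 1` in binary,
most significant bit first, and delete the leading `1`. So `0, 1, 2, 3, …` become
`ε, 0, 1, 00, …`. -/
def strOfNat (n : ℕ) : BinStr := (Nat.bits (n + 1)).dropLast.reverse

/-- `U y P` is the (possibly undefined) output of the machine `U` on input `⟨y, P⟩`, where `P` is
the program. `U` is universal if every partial computable function of strings is computed by some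
program, and additively optimal if descriptions with respect to any other machine can be replaced
by `U`-descriptions that are longer by at most a constant. -/
structure IsUniversalOptimal (U : BinStr → BinStr →. BinStr) : Prop where
  partrec : Partrec₂ U
  universal : ∀ f : BinStr →. BinStr, Partrec f → ∃ P : BinStr, ∀ y, U y P = f y
  optimal : ∀ V : BinStr → BinStr →. BinStr, Partrec₂ V →
    ∃ c : ℕ, ∀ x y P, x ∈ V y P → ∃ Q : BinStr, Q.length ≤ P.length + c ∧ x ∈ U y Q

/-- Conditional Kolmogorov complexity `C(x | y)` with respect to `U`: the least length of a
program that outputs `x` on input `y`. -/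
noncomputable def condC (U : BinStr → BinStr →. BinStr) (x y : BinStr) : ℕ :=
  sInf {l : ℕ | ∃ P : BinStr, P.length = l ∧ x ∈ U y P}

/-- Kolmogorov complexity `C(x) = C(x | ε)` of a string. -/
noncomputable def C (U : BinStr → BinStr →. BinStr) (x : BinStr) : ℕ := condC U x []

/-- Kolmogorov complexity `C(n)` of a natural number. -/
noncomputable def CNat (U : BinStr → BinStr →. BinStr) (n : ℕ) : ℕ := C U (strOfNat n)

/-- The `i`-th binary digit (counted from `0`) of the real `α` after the binary point. -/
noncomputable def bit (α : ℝ) (i : ℕ) : Bool := decide (Real.digits (Int.fract α) 2 i = 1)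

/-- `α_n`: the string of the first `n` binary digits of `α`. -/
noncomputable def initSeg (α : ℝ) (n : ℕ) : BinStr := (List.range n).map (bit α)

/-- The rational coded by a natural number: the code `⟨⟨a, b⟩, c⟩` stands for
`(a - b) / (c + 1)`. Every rational has a code. -/
def ratOfNat (m : ℕ) : ℚ :=
  ((m.unpair.1.unpair.1 : ℚ) - (m.unpair.1.unpair.2 : ℚ)) / ((m.unpair.2 : ℚ) + 1)

/-- `q` lists (codes of) a nondecreasing sequence of rationals with limit `α`. -/
def ApproximatesFromBelow (q : ℕ → ℕ) (α : ℝ) : Prop :=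
  Monotone (fun s => ratOfNat (q s)) ∧
    Filter.Tendsto (fun s => ((ratOfNat (q s) : ℚ) : ℝ)) Filter.atTop (nhds α)

/-- `α` is a left c.e. real: the limit of a computable nondecreasing sequence of rationals. -/
def IsLeftCE (α : ℝ) : Prop :=
  ∃ q : ℕ → ℕ, Computable q ∧ ApproximatesFromBelow q α

/-- `P` is a `U`-program that enumerates a nondecreasing sequence of rationals with limit `α`:
on input `s` it outputs the `s`-th rational. -/
def Enumerates (U : BinStr → BinStr →. BinStr) (P : BinStr) (α : ℝ) : Prop :=
  ∃ q : ℕ → ℕ, (∀ s, strOfNat (q s) ∈ U (strOfNat s) P) ∧ ApproximatesFromBelow q α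

/-- `α` is computable: its sequence of binary digits is. -/
def IsComputableReal (α : ℝ) : Prop := Computable (bit α)

/-- The binary digits of `α` as an oracle. -/
noncomputable def oracle (α : ℝ) : ℕ →. ℕ := fun i => Part.some (bit α i).toNat

open Classical in
/-- The characteristic function of the halting problem: does the `e`-th program halt on
input `e`? -/
noncomputable def haltingChar : ℕ →. ℕ := fun e =>
  Part.some (if ((Denumerable.ofNat Nat.Partrec.Code e).eval e).Dom then 1 else 0)

/-- `α` is Turing-complete: the halting problem is Turing-reducible to `α`. -/
def IsTuringComplete (α : ℝ) : Prop := TuringReducible haltingChar (oracle α)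

end LeftCE

/-! Infinitely many simple segments: the running time of the `n`-th program on input `n` serves as a
clock. Suppose that, with finitely many exceptions, every halting computation ended before the
approximation to `α_n` became correct. Then `α` would solve the halting problem: wait until the
approximation agrees with `α_n` and see whether the computation has halted. So if `α` is incomplete,
for infinitely many `n` the approximation taken at the halting time already gives `α_n`
(`infinite_settled_at_halting`). For these `n`, a shortest program for `n`, preceded by `P` and its
length in unary, describes `α_n`; the overhead depends only on the length of `P`
(`exists_infinite_C_initSeg_lt`).

Unboundedness: suppose `C(α_n) ≤ C(n) + k` for all `n`, and consider the `2 ^ m` lengths `n` whose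
strings have length `m`. All these `α_n` have programs of length less than `m + c`, so attention can
be restricted to stages at which the approximations to all of them have such programs. Some such `n`
is incompressible, and then only boundedly many strings of length `n` have such short programs: few
lengths can be popular, so a popular one is described by its index among them
(`exists_card_le_of_incompressible`). Hence the first `2 ^ m - 1` digits take boundedly many values
at these stages, uniformly in `m`. Knowing the number of values taken for infinitely many `m`
identifies the last, correct one, so `α` is computable (`isComputableReal_of_bounded_revisions`,
`isComputableReal_of_C_le`). -/

namespace LeftCE

/-! ### Closure properties of computable functions -/

section Computability

variable {β σ : Type*} [Primcodable β] [Primcodable σ]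

theorem computable_forall_lt {p : β → ℕ → Bool} (hp : Computable₂ p) :
    Computable₂ fun a n => decide (∀ i < n, p a i = true) := by
  have h : Computable₂ fun (a : β) (n : ℕ) =>
      (Nat.rec true (fun i b => b && p a i) n : Bool) := by
    refine Computable.nat_rec (f := fun x : β × ℕ => x.2) (g := fun _ => true)
      (h := fun x y => y.2 && p x.1 y.1) Computable.snd (Computable.const _) ?_
    exact (Primrec.and.to_comp.comp (Computable.snd.comp Computable.snd)
      (hp.comp (Computable.fst.comp Computable.fst) (Computable.fst.comp Computable.snd)))
  refine h.of_eq fun x => ?_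
  obtain ⟨a, n⟩ := x
  induction n with
  | zero => simp
  | succ n ih =>
    simp only at ih ⊢
    rw [ih]
    simp only [Nat.lt_succ_iff_lt_or_eq, or_imp, forall_and, forall_eq, Bool.decide_and,
      Bool.decide_eq_true]

theorem computable_exists_lt {p : β → ℕ → Bool} (hp : Computable₂ p) :
    Computable₂ fun a n => decide (∃ i < n, p a i = true) := by
  have h := Primrec.not.to_comp.comp
    (computable_forall_lt (p := fun a i => !p a i) (Primrec.not.to_comp.comp hp))
  refine h.of_eq fun x => ?_
  rw [Bool.eq_iff_iff]
  simp

theorem computable_count {p : β → ℕ → Bool} (hp : Computable₂ p) :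
    Computable₂ fun a n => Nat.count (fun i => p a i = true) n := by
  have h : Computable₂ fun (a : β) (n : ℕ) =>
      (Nat.rec 0 (fun i k => k + (cond (p a i) 1 0)) n : ℕ) := by
    refine Computable.nat_rec (f := fun x : β × ℕ => x.2) (g := fun _ => 0)
      (h := fun x y => y.2 + (cond (p x.1 y.1) 1 0)) Computable.snd (Computable.const _) ?_
    exact (Primrec.nat_add.to_comp.comp (Computable.snd.comp Computable.snd)
      (Computable.cond (hp.comp (Computable.fst.comp Computable.fst)
        (Computable.fst.comp Computable.snd)) (Computable.const _) (Computable.const _)))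
  refine h.of_eq fun x => ?_
  obtain ⟨a, n⟩ := x
  induction n with
  | zero => simp
  | succ n ih =>
    simp only at ih ⊢
    rw [ih, Nat.count_succ]
    cases p a n <;> simp

theorem computable_and {p q : β → Bool} (hp : Computable p) (hq : Computable q) :
    Computable fun a => p a && q a :=
  Primrec.and.to_comp.comp hp hq

theorem computable_decide_eq {f g : β → σ} [DecidableEq σ] (hf : Computable f)
    (hg : Computable g) : Computable fun a => decide (f a = g a) :=
  Primrec.eq.decide.to_comp.comp hf hg

theorem computable_decide_le {f g : β → ℕ} (hf : Computable f) (hg : Computable g) :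
    Computable fun a => decide (f a ≤ g a) :=
  Primrec.nat_le.decide.to_comp.comp hf hg

theorem primrec_pow : Primrec₂ fun a b : ℕ => a ^ b :=
  Primrec₂.unpaired'.1 Nat.Primrec.pow

/-- A partial recursive function is the increasing union of computable finite-stage
approximations. -/
theorem exists_stages {f : β →. σ} (hf : Partrec f) :
    ∃ u : ℕ → β → Option σ, Computable₂ u ∧
      (∀ s t a x, s ≤ t → u s a = some x → u t a = some x) ∧
      ∀ a x, x ∈ f a ↔ ∃ t, u t a = some x := by
  obtain ⟨c, hc⟩ := Nat.Partrec.Code.exists_code.1 hf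
  refine ⟨fun t a => (Nat.Partrec.Code.evaln t c (Encodable.encode a)).bind Encodable.decode,
    ?_, ?_, ?_⟩
  · refine Primrec.to_comp ?_
    refine Primrec.option_bind ?_ (Primrec.decode.comp Primrec.snd)
    exact Nat.Partrec.Code.primrec_evaln.comp
      ((Primrec.fst.pair (Primrec.const c)).pair (Primrec.encode.comp Primrec.snd))
  · intro s t a x hst h
    simp only [Option.bind_eq_some_iff] at h ⊢
    obtain ⟨y, hy, hyx⟩ := h
    exact ⟨y, Nat.Partrec.Code.evaln_mono hst hy, hyx⟩
  · intro a x
    have key : ∀ y, y ∈ Nat.Partrec.Code.eval c (Encodable.encode a) ↔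
        ∃ x ∈ f a, Encodable.encode x = y := by
      intro y
      rw [hc]
      simp
    constructor
    · intro hx
      obtain ⟨k, hk⟩ := Nat.Partrec.Code.evaln_complete.1 ((key _).2 ⟨x, hx, rfl⟩)
      exact ⟨k, by simp [Option.mem_def.1 hk]⟩
    · rintro ⟨t, ht⟩
      simp only [Option.bind_eq_some_iff] at ht
      obtain ⟨y, hy, hyx⟩ := ht
      obtain ⟨x', hx', rfl⟩ := (key y).1 (Nat.Partrec.Code.evaln_sound hy)
      simp only [Encodable.encodek, Option.some.injEq] at hyx
      exact hyx ▸ hx'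

end Computability

/-! ### The numbering of binary strings -/

/-- The inverse of `strOfNat`. -/
def natOfStr (l : BinStr) : ℕ := l.foldl (fun n b => 2 * n + b.toNat) 1 - 1

theorem natOfStr_append (l : BinStr) (b : Bool) :
    natOfStr (l ++ [b]) = 2 * natOfStr l + 1 + b.toNat := by
  have h : ∀ (l : BinStr) (n : ℕ), 1 ≤ n → 1 ≤ l.foldl (fun n b => 2 * n + b.toNat) n := by
    intro l
    induction l with
    | nil => simp
    | cons b l ih => intro n hn; exact ih (2 * n + b.toNat) (by omega)
  have := h l 1 le_rfl
  simp only [natOfStr, List.foldl_append, List.foldl_cons, List.foldl_nil]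
  omega

theorem strOfNat_step (n : ℕ) (b : Bool) :
    strOfNat (2 * n + 1 + b.toNat) = strOfNat n ++ [b] := by
  have h : 2 * n + 1 + b.toNat + 1 = Nat.bit b (n + 1) := by
    cases b <;> simp [Nat.bit] <;> omega
  have hne : (n + 1).bits ≠ [] := by
    intro h0
    have := congrArg List.length h0
    rw [Nat.size_eq_bits_len] at this
    have := Nat.size_eq_zero.1 this
    omega
  rw [strOfNat, h, Nat.bits_append_bit _ _ (by simp), List.dropLast_cons_of_ne_nil hne,
    List.reverse_cons, strOfNat]

theorem strOfNat_natOfStr (l : BinStr) : strOfNat (natOfStr l) = l := by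
  induction l using List.reverseRecOn with
  | nil => simp [natOfStr, strOfNat]
  | append_singleton l b ih => rw [natOfStr_append, strOfNat_step, ih]

theorem natOfStr_strOfNat (n : ℕ) : natOfStr (strOfNat n) = n := by
  induction n using Nat.strong_induction_on with
  | _ n ih =>
    rcases n with _ | n
    · simp [natOfStr, strOfNat]
    · have h : n + 1 = 2 * (n / 2) + 1 + (decide (n % 2 = 1)).toNat := by
        by_cases h : n % 2 = 1 <;> simp [h] <;> omega
      rw [h, strOfNat_step, natOfStr_append, ih _ (by omega)]

theorem natOfStr_bounds (l : BinStr) :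
    2 ^ l.length ≤ natOfStr l + 1 ∧ natOfStr l + 1 < 2 ^ (l.length + 1) := by
  induction l using List.reverseRecOn with
  | nil => simp [natOfStr]
  | append_singleton l b ih =>
    rw [natOfStr_append, List.length_append, List.length_singleton]
    have : b.toNat ≤ 1 := Bool.toNat_le b
    rw [pow_succ] at ih ⊢
    rw [pow_succ, pow_succ]
    omega

theorem primrec_natOfStr : Primrec natOfStr := by
  refine Primrec.nat_sub.comp (Primrec.list_foldl Primrec.id (Primrec.const 1)
    (h := fun _ (x : ℕ × Bool) => 2 * x.1 + x.2.toNat) ?_) (Primrec.const 1)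
  exact Primrec.nat_add.comp (Primrec.nat_double.comp (Primrec.fst.comp Primrec.snd))
    ((Primrec.dom_bool Bool.toNat).comp (Primrec.snd.comp Primrec.snd))

theorem computable_natOfStr : Computable natOfStr := primrec_natOfStr.to_comp

theorem computable_strOfNat : Computable strOfNat := by
  -- The inverse of the computable bijection `natOfStr` is found by searching through codes of
  -- strings.
  let g : ℕ → ℕ → Option BinStr := fun n k => (Encodable.decode (α := BinStr) k).bind fun l =>
    cond (decide (natOfStr l = n)) (some l) none
  have h : Partrec fun n : ℕ => Nat.rfindOpt (g n) := by
    refine Partrec.rfindOpt (Computable.option_bind (Computable.decode.comp Computable.snd)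
      (Computable.cond ?_ (Computable.option_some.comp Computable.snd) (Computable.const none)))
    exact computable_decide_eq (computable_natOfStr.comp Computable.snd)
      (Computable.fst.comp Computable.fst)
  have hg : ∀ n k l, g n k = some l → l = strOfNat n := by
    intro n k l hl
    simp only [g, Option.bind_eq_some_iff] at hl
    obtain ⟨l', -, hl'⟩ := hl
    by_cases hn : natOfStr l' = n
    · simp only [hn, decide_true, cond_true, Option.some.injEq] at hl'
      rw [← hl', ← hn, strOfNat_natOfStr]
    · simp [hn] at hl'
  refine h.of_eq_tot fun n => ?_
  have hd : (Nat.rfindOpt (g n)).Dom := Nat.rfindOpt_dom.2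
    ⟨Encodable.encode (strOfNat n), strOfNat n, by simp [g, natOfStr_strOfNat]⟩
  obtain ⟨k, hk⟩ := Nat.rfindOpt_spec (Part.get_mem hd)
  rw [← hg n k _ hk]
  exact Part.get_mem hd

/-! ### Binary digits of reals -/

/-- The integer part of `x` contributes an even number to the scaled floor, so the fractional part
can be dropped from the parity. -/
theorem bit_eq (x : ℝ) (i : ℕ) : bit x i = decide (⌊x * 2 ^ (i + 1)⌋ % 2 = 1) := by
  have h1 : ⌊x * 2 ^ (i + 1)⌋ =
      ⌊Int.fract x * 2 ^ (i + 1)⌋ + ⌊x⌋ * 2 ^ (i + 1) := by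
    rw [← Int.floor_add_intCast]
    congr 1
    have := Int.fract_add_floor x
    push_cast
    nth_rewrite 1 [← this]
    ring
  have h0 : 0 ≤ Int.fract x * 2 ^ (i + 1) := by
    have := Int.fract_nonneg x
    positivity
  have h2 : (⌊Int.fract x * 2 ^ (i + 1)⌋₊ : ℤ) = ⌊Int.fract x * 2 ^ (i + 1)⌋ :=
    Int.natCast_floor_eq_floor h0
  rw [bit, Real.digits, decide_eq_decide, h1, ← h2, Fin.ext_iff, pow_succ (2 : ℤ), ← mul_assoc,
    Int.add_mul_emod_self_right]
  simp only [Fin.val_ofNat, Nat.cast_ofNat, Fin.val_one]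
  omega

theorem floor_mul_two_pow_succ (x : ℝ) (n : ℕ) :
    ⌊x * 2 ^ (n + 1)⌋ = 2 * ⌊x * 2 ^ n⌋ + (bit x n).toNat := by
  have h : ⌊x * 2 ^ n⌋ = ⌊x * 2 ^ (n + 1)⌋ / 2 := by
    rw [show x * 2 ^ n = x * 2 ^ (n + 1) / (2 : ℕ) by push_cast; ring, Int.floor_div_natCast]
    rfl
  rw [h, bit_eq]
  by_cases h1 : ⌊x * 2 ^ (n + 1)⌋ % 2 = 1 <;> simp [h1] <;> omega

@[simp]
theorem length_initSeg (x : ℝ) (n : ℕ) : (initSeg x n).length = n := by simp [initSeg]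

theorem initSeg_succ (x : ℝ) (n : ℕ) : initSeg x (n + 1) = initSeg x n ++ [bit x n] := by
  simp [initSeg, List.range_succ]

theorem take_initSeg (x : ℝ) {n m : ℕ} (h : n ≤ m) : (initSeg x m).take n = initSeg x n := by
  simp [initSeg, ← List.map_take, List.take_range, h]

theorem getElem?_initSeg (x : ℝ) {i n : ℕ} (h : i < n) : (initSeg x n)[i]? = some (bit x i) := by
  simp [initSeg, h]

/-- Digits see only the fractional part, so the integer parts must agree. Floors, unlike strings of
digits, are monotone, which is what the approximation argument uses. -/
theorem initSeg_eq_iff_floor_eq {x y : ℝ} (hxy : ⌊x⌋ = ⌊y⌋) (n : ℕ) :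
    initSeg x n = initSeg y n ↔ ⌊x * 2 ^ n⌋ = ⌊y * 2 ^ n⌋ := by
  induction n with
  | zero => simp [initSeg, hxy]
  | succ n ih =>
    rw [initSeg_succ, initSeg_succ, List.append_singleton_inj, ih, floor_mul_two_pow_succ,
      floor_mul_two_pow_succ]
    constructor
    · rintro ⟨h1, h2⟩
      rw [h1, h2]
    · intro h
      cases hx : bit x n <;> cases hy : bit y n <;> simp [hx, hy] at h ⊢ <;> omega

/-- A real some dyadic multiple of which is an integer is computable. -/
theorem isComputableReal_of_dyadic {x : ℝ} {n : ℕ} (h : (⌊x * 2 ^ n⌋ : ℝ) = x * 2 ^ n) :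
    IsComputableReal x := by
  have hz : ∀ i, n ≤ i → bit x i = false := by
    intro i hi
    have : x * 2 ^ (i + 1) = ((⌊x * 2 ^ n⌋ * 2 ^ (i - n) * 2 : ℤ) : ℝ) := by
      push_cast
      rw [h, show i + 1 = n + (i - n) + 1 by omega, pow_succ, pow_add]
      ring
    rw [bit_eq, this, Int.floor_intCast]
    simp
  refine ((Primrec.list_getD false).comp (Primrec.const (initSeg x n)) Primrec.id).to_comp.of_eq
    fun i => ?_
  rcases lt_or_ge i n with hi | hi
  · simp [List.getD_eq_getElem?_getD, getElem?_initSeg x hi]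
  · rw [hz i hi, List.getD_eq_default]
    simpa using hi

theorem primrec_initSeg_ratOfNat : Primrec₂ fun m n : ℕ => initSeg ((ratOfNat m : ℚ) : ℝ) n := by
  have key : ∀ m i : ℕ, bit ((ratOfNat m : ℚ) : ℝ) i = decide
      (((m.unpair.1.unpair.1 + m.unpair.1.unpair.2 * m.unpair.2) * 2 ^ (i + 1) /
        (m.unpair.2 + 1)) % 2 = 1) := by
    intro m i
    obtain ⟨a, ha⟩ : ∃ a, a = m.unpair.1.unpair.1 := ⟨_, rfl⟩
    obtain ⟨b, hb⟩ : ∃ b, b = m.unpair.1.unpair.2 := ⟨_, rfl⟩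
    obtain ⟨c, hc⟩ : ∃ c, c = m.unpair.2 := ⟨_, rfl⟩
    rw [bit_eq, ratOfNat, ← ha, ← hb, ← hc, decide_eq_decide]
    -- Adding the integer `b` makes the numerator nonnegative, so natural division applies; after
    -- scaling, the correction is even and leaves the parity alone.
    have h1 : (((((a : ℚ) - (b : ℚ)) / ((c : ℚ) + 1) : ℚ)) : ℝ) * 2 ^ (i + 1) =
        (((a + b * c) * 2 ^ (i + 1) : ℕ) : ℝ) / ((c + 1 : ℕ) : ℝ) -
          ((b * 2 ^ (i + 1) : ℤ) : ℝ) := by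
      have : (c : ℝ) + 1 ≠ 0 := by positivity
      push_cast
      field_simp
      ring
    have h2 : ⌊(((a + b * c) * 2 ^ (i + 1) : ℕ) : ℝ) / ((c + 1 : ℕ) : ℝ)⌋ =
        (((a + b * c) * 2 ^ (i + 1) / (c + 1) : ℕ) : ℤ) := by
      rw [Int.floor_div_natCast, Int.floor_natCast, Int.natCast_div]
    rw [h1, Int.floor_sub_intCast, h2, pow_succ (2 : ℤ), ← mul_assoc]
    omega
  have hp : Primrec₂ fun m i : ℕ => decide
      (((m.unpair.1.unpair.1 + m.unpair.1.unpair.2 * m.unpair.2) * 2 ^ (i + 1) /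
        (m.unpair.2 + 1)) % 2 = 1) := by
    have hu : Primrec fun x : ℕ × ℕ => x.1.unpair := Primrec.unpair.comp Primrec.fst
    have hu1 : Primrec fun x : ℕ × ℕ => x.1.unpair.1.unpair :=
      Primrec.unpair.comp (Primrec.fst.comp hu)
    refine Primrec.eq.decide.comp (Primrec.nat_mod.comp (Primrec.nat_div.comp
      (Primrec.nat_mul.comp (Primrec.nat_add.comp (Primrec.fst.comp hu1) (Primrec.nat_mul.comp
        (Primrec.snd.comp hu1) (Primrec.snd.comp hu))) (primrec_pow.comp (Primrec.const 2)
          (Primrec.succ.comp Primrec.snd))) (Primrec.succ.comp (Primrec.snd.comp hu)))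
            (Primrec.const 2)) (Primrec.const 1)
  refine (Primrec.list_map (f := fun x : ℕ × ℕ => List.range x.2)
    (Primrec.list_range.comp Primrec.snd) (hp.comp (Primrec.fst.comp Primrec.fst)
      Primrec.snd).to₂).of_eq fun x => ?_
  simp [initSeg, key]

/-- The initial segments of the approximations to a non-computable left c.e. real are eventually
correct, and from some stage on a correct segment stays correct. -/
theorem exists_stage_initSeg_stable {α : ℝ} (hα : ¬ IsComputableReal α) {q : ℕ → ℕ}
    (hq : ApproximatesFromBelow q α) :
    ∃ s₀, (∀ n, ∃ s, s₀ ≤ s ∧ initSeg ((ratOfNat (q s) : ℚ) : ℝ) n = initSeg α n) ∧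
      ∀ n s t, s₀ ≤ s → s ≤ t → initSeg ((ratOfNat (q s) : ℚ) : ℝ) n = initSeg α n →
        initSeg ((ratOfNat (q t) : ℚ) : ℝ) n = initSeg α n := by
  obtain ⟨hmono, hlim⟩ := hq
  have hmono' : Monotone fun s => ((ratOfNat (q s) : ℚ) : ℝ) := fun s t h =>
    Rat.cast_le.2 (hmono h)
  have hle : ∀ s, ((ratOfNat (q s) : ℚ) : ℝ) ≤ α := fun s => hmono'.ge_of_tendsto hlim s
  -- As `α` is not dyadic, `α * 2 ^ n` lies strictly above its floor, so an approximation from below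
  -- eventually passes the floor.
  have hfl : ∀ n, ∀ᶠ s in Filter.atTop, ⌊((ratOfNat (q s) : ℚ) : ℝ) * 2 ^ n⌋ = ⌊α * 2 ^ n⌋ := by
    intro n
    have hlt : (⌊α * 2 ^ n⌋ : ℝ) < α * 2 ^ n :=
      lt_of_le_of_ne (Int.floor_le _) fun h => hα (isComputableReal_of_dyadic h)
    filter_upwards [(hlim.mul_const (2 ^ n)).eventually (lt_mem_nhds hlt)] with s hs
    apply le_antisymm
    · exact Int.floor_mono (mul_le_mul_of_nonneg_right (hle s) (by positivity))
    · exact Int.le_floor.2 hs.le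
  -- From `s₀` on the integer part is that of `α`. Earlier, digits could agree by accident and
  -- change again.
  obtain ⟨s₀, hs₀⟩ := Filter.eventually_atTop.1 (hfl 0)
  simp only [pow_zero, mul_one] at hs₀
  refine ⟨s₀, fun n => ?_, fun n s t hs hst h => ?_⟩
  · obtain ⟨s, h1, h2⟩ := ((hfl n).and (Filter.eventually_ge_atTop s₀)).exists
    exact ⟨s, h2, (initSeg_eq_iff_floor_eq (hs₀ s h2) n).2 h1⟩
  · rw [initSeg_eq_iff_floor_eq (hs₀ _ hs)] at h
    rw [initSeg_eq_iff_floor_eq (hs₀ _ (hs.trans hst))]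
    refine le_antisymm (Int.floor_mono (mul_le_mul_of_nonneg_right (hle t) (by positivity))) ?_
    rw [← h]
    exact Int.floor_mono (mul_le_mul_of_nonneg_right (hmono' hst) (by positivity))

/-! ### Plain complexity -/

section Complexity

variable {U : BinStr → BinStr →. BinStr}

theorem C_le_length_program {x P : BinStr} (h : x ∈ U [] P) : C U x ≤ P.length :=
  Nat.sInf_le ⟨P, rfl, h⟩

theorem IsUniversalOptimal.exists_C_le (hU : IsUniversalOptimal U) {W : BinStr →. BinStr}
    (hW : Partrec W) : ∃ c, ∀ x P, x ∈ W P → C U x ≤ P.length + c := by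
  obtain ⟨c, hc⟩ := hU.optimal (fun _ P => W P) (hW.comp Computable.snd)
  refine ⟨c, fun x P h => ?_⟩
  obtain ⟨Q, hQ, hx⟩ := hc x [] P h
  exact (C_le_length_program hx).trans hQ

theorem IsUniversalOptimal.exists_minimal_program (hU : IsUniversalOptimal U) (x : BinStr) :
    ∃ P : BinStr, P.length = C U x ∧ x ∈ U [] P := by
  obtain ⟨c, hc⟩ := hU.optimal (fun _ P => Part.some P) Computable.snd
  obtain ⟨Q, -, hx⟩ := hc x [] x (Part.mem_some x)
  exact Nat.sInf_mem (s := {l : ℕ | ∃ P : BinStr, P.length = l ∧ x ∈ U [] P}) ⟨_, Q, rfl, hx⟩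

theorem IsUniversalOptimal.exists_C_le_length (hU : IsUniversalOptimal U) :
    ∃ c, ∀ x : BinStr, C U x ≤ x.length + c := by
  obtain ⟨c, hc⟩ := hU.exists_C_le (W := fun P => Part.some P) Computable.id
  exact ⟨c, fun x => hc x x (Part.mem_some x)⟩

end Complexity

/-! ### Unary prefixes -/

/-- The number of leading ones of a string. -/
def unaryLen (P : BinStr) : ℕ := (P.takeWhile id).length

/-- What follows the block of leading ones and the zero that ends it. -/
def unaryRest (P : BinStr) : BinStr := (P.dropWhile id).tail

theorem unaryLen_replicate (l : ℕ) (z : BinStr) :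
    unaryLen (List.replicate l true ++ false :: z) = l := by
  induction l with
  | zero => simp [unaryLen]
  | succ l => simp [unaryLen, List.replicate_succ]

theorem unaryRest_replicate (l : ℕ) (z : BinStr) :
    unaryRest (List.replicate l true ++ false :: z) = z := by
  induction l with
  | zero => simp [unaryRest]
  | succ l => simp [unaryRest, List.replicate_succ]

theorem computable_unaryLen : Computable unaryLen :=
  (Primrec.list_length.comp (Primrec.list_takeWhile Primrec.id)).to_comp

theorem computable_unaryRest : Computable unaryRest :=
  (Primrec.list_tail.comp (Primrec.list_dropWhile Primrec.id)).to_comp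

/-! ### Computing from the initial segments of a real -/

theorem recursiveIn_comp_total {O : Set (ℕ →. ℕ)} {f g : ℕ → ℕ}
    (hf : Nat.RecursiveIn O fun n => Part.some (f n))
    (hg : Nat.RecursiveIn O fun n => Part.some (g n)) :
    Nat.RecursiveIn O fun n => Part.some (f (g n)) :=
  (Nat.RecursiveIn.comp hf hg).of_eq fun _ => Part.bind_some _ _

theorem recursiveIn_pair_total {O : Set (ℕ →. ℕ)} {f g : ℕ → ℕ}
    (hf : Nat.RecursiveIn O fun n => Part.some (f n))
    (hg : Nat.RecursiveIn O fun n => Part.some (g n)) :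
    Nat.RecursiveIn O fun n => Part.some (Nat.pair (f n) (g n)) :=
  (Nat.RecursiveIn.pair hf hg).of_eq fun n => by simp [Seq.seq]

theorem recursiveIn_rec_total {O : Set (ℕ →. ℕ)} {h : ℕ → ℕ} (a : ℕ)
    (hh : Nat.RecursiveIn O fun n => Part.some (h n)) :
    Nat.RecursiveIn O fun n => Part.some (Nat.rec a (fun y i => h (Nat.pair y i)) n) := by
  have hprec := Nat.RecursiveIn.prec (O := O) (Nat.Primrec.const a).recursiveIn
    (recursiveIn_comp_total hh .right)
  have hpair : Nat.RecursiveIn O fun n => Part.some (Nat.pair 0 n) :=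
    (Primrec.nat_iff.1 (Primrec₂.natPair.comp (Primrec.const 0) Primrec.id)).recursiveIn
  refine (Nat.RecursiveIn.comp hprec hpair).of_eq fun n => ?_
  refine (Part.bind_some _ _).trans ?_
  simp only [Nat.unpair_pair]
  induction n with
  | zero => rfl
  | succ n ih =>
    simp only [ih]
    exact Part.bind_some _ _

/-- A function whose value at `n` is computable from `n` and the first `n` digits of `α` is
Turing-reducible to `α`. -/
theorem turingReducible_oracle {α : ℝ} {G : ℕ → BinStr →. ℕ} (hG : Partrec₂ G) {f : ℕ → ℕ}
    (hf : ∀ n, f n ∈ G n (initSeg α n)) :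
    TuringReducible (fun n => Part.some (f n)) (oracle α) := by
  refine RecursiveIn.iff_nat.2 ?_
  -- On codes: append one oracle digit to a string, so that initial segments arise by recursion
  -- relative to `α`.
  let step : ℕ → ℕ := fun p =>
    Encodable.encode (((Encodable.decode (α := BinStr) p.unpair.1).getD []) ++
      [decide (p.unpair.2 = 1)])
  have hstep : Primrec step := by
    refine Primrec.encode.comp (Primrec.list_concat.comp (Primrec.option_getD.comp
      (Primrec.decode.comp (Primrec.fst.comp Primrec.unpair)) (Primrec.const [])) ?_)
    exact Primrec.eq.decide.comp (Primrec.snd.comp Primrec.unpair) (Primrec.const 1)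
  have hbit : Nat.RecursiveIn {oracle α} fun n => Part.some (bit α n).toNat := .oracle _ rfl
  have hE : Nat.RecursiveIn {oracle α} fun n => Part.some (Encodable.encode (initSeg α n)) := by
    refine (recursiveIn_rec_total (Encodable.encode ([] : BinStr)) (recursiveIn_comp_total
      (Primrec.nat_iff.1 hstep).recursiveIn (recursiveIn_pair_total .right
        (recursiveIn_comp_total hbit .left)))).of_eq fun n => congrArg Part.some ?_
    induction n with
    | zero => rfl
    | succ n ih =>
      simp only at ih ⊢
      rw [ih, initSeg_succ]
      cases h : bit α n <;> simp [step, h]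
  let G' : ℕ →. ℕ := fun p => (Encodable.decode (α := BinStr) p.unpair.2 : Part BinStr).bind
    fun l => G p.unpair.1 l
  have hG' : Partrec G' := by
    refine Partrec.bind (Computable.ofOption (Computable.decode.comp
      (Computable.snd.comp Computable.unpair))) ?_
    exact hG.comp (Computable.fst.comp (Computable.unpair.comp Computable.fst)) Computable.snd
  refine (Nat.RecursiveIn.comp (Partrec.nat_iff.1 hG').recursiveIn (recursiveIn_pair_total
    (Primrec.nat_iff.1 Primrec.id).recursiveIn hE)).of_eq fun n => ?_
  refine (Part.bind_some _ _).trans ?_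
  simp [G', Part.eq_some_iff.2 (hf n)]

/-! ### Infinitely many initial segments of low complexity -/

/-- Does the `e`-th program halt on input `e` within `s` steps? -/
def haltsWithin (e s : ℕ) : Bool :=
  (Nat.Partrec.Code.evaln s (Denumerable.ofNat Nat.Partrec.Code e) e).isSome

theorem primrec_haltsWithin : Primrec₂ haltsWithin :=
  Primrec.option_isSome.comp (Nat.Partrec.Code.primrec_evaln.comp
    ((Primrec.snd.pair ((Primrec.ofNat _).comp Primrec.fst)).pair Primrec.fst))

theorem haltsWithin_mono {e s t : ℕ} (hst : s ≤ t) (h : haltsWithin e s) : haltsWithin e t := by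
  obtain ⟨x, hx⟩ := Option.isSome_iff_exists.1 h
  exact Option.isSome_iff_exists.2 ⟨x, Nat.Partrec.Code.evaln_mono hst hx⟩

theorem dom_iff_exists_haltsWithin (e : ℕ) :
    ((Denumerable.ofNat Nat.Partrec.Code e).eval e).Dom ↔ ∃ s, haltsWithin e s := by
  constructor
  · intro h
    obtain ⟨s, hs⟩ := Nat.Partrec.Code.evaln_complete.1 (Part.get_mem h)
    exact ⟨s, Option.isSome_iff_exists.2 ⟨_, hs⟩⟩
  · rintro ⟨s, hs⟩
    obtain ⟨x, hx⟩ := Option.isSome_iff_exists.1 hs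
    exact Part.dom_iff_mem.2 ⟨x, Nat.Partrec.Code.evaln_sound hx⟩

/-- If `α` is Turing-incomplete, then for infinitely many `e` the `e`-th program halts on `e` only
after the first `e` digits of the approximation to `α` have settled. -/
theorem infinite_settled_at_halting {α : ℝ} (hα : ¬ IsTuringComplete α) {A : ℕ → ℕ → BinStr}
    (hA : Computable₂ A) {s₀ : ℕ} (hlim : ∀ n, ∃ s, s₀ ≤ s ∧ A s n = initSeg α n)
    (hstab : ∀ n s t, s₀ ≤ s → s ≤ t → A s n = initSeg α n → A t n = initSeg α n) :
    {e | ∃ s, haltsWithin e s = true ∧ (∀ t < s, haltsWithin e t = false) ∧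
      A s e = initSeg α e}.Infinite := by
  intro hfin
  apply hα
  -- `M` bounds the halting times of the finitely many exceptional `e`.
  obtain ⟨M, hM⟩ : ∃ M, ∀ e, (∃ s, haltsWithin e s = true ∧
      (∀ t < s, haltsWithin e t = false) ∧ A s e = initSeg α e) → haltsWithin e M = true := by
    have : ∀ e ∈ {e | ∃ s, haltsWithin e s = true ∧ (∀ t < s, haltsWithin e t = false) ∧
        A s e = initSeg α e}, ∀ᶠ M in Filter.atTop, haltsWithin e M = true := by
      rintro e ⟨s, hs, -⟩
      filter_upwards [Filter.eventually_ge_atTop s] with t ht using haltsWithin_mono ht hs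
    exact ((Filter.eventually_all_finite hfin).2 this).exists
  let G : ℕ → BinStr →. ℕ := fun e x =>
    (Nat.rfind fun s => Part.some (decide (max s₀ M ≤ s) && decide (A s e = x))).map
      fun s => (haltsWithin e s).toNat
  have hG : Partrec₂ G := by
    refine Partrec.map (Partrec.rfind ?_) ?_
    · refine computable_and (computable_decide_le (Computable.const _) Computable.snd)
        (computable_decide_eq (hA.comp Computable.snd (Computable.fst.comp Computable.fst))
          (Computable.snd.comp Computable.fst))
    · exact (Primrec.dom_bool Bool.toNat).to_comp.comp (primrec_haltsWithin.to_comp.comp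
        (Computable.fst.comp Computable.fst) Computable.snd)
  classical
  refine turingReducible_oracle (f := fun e =>
    if ((Denumerable.ofNat Nat.Partrec.Code e).eval e).Dom then 1 else 0) hG fun e => ?_
  obtain ⟨s₁, hs₁, hAs₁⟩ := hlim e
  obtain ⟨s, hs, -⟩ := Nat.rfind_min' (p := fun s =>
    decide (max s₀ M ≤ s) && decide (A s e = initSeg α e)) (m := max s₁ M) (by
      rw [Bool.and_eq_true, decide_eq_true_eq, decide_eq_true_eq]
      exact ⟨max_le_max_right M hs₁, hstab e _ _ hs₁ (le_max_left _ _) hAs₁⟩)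
  have hspec := Nat.rfind_spec hs
  simp only [PFun.coe_val, Part.mem_some_iff, eq_comm (a := true), Bool.and_eq_true,
    decide_eq_true_eq, max_le_iff] at hspec
  obtain ⟨⟨hs₀, hsM⟩, hAs⟩ := hspec
  refine (Part.mem_map_iff _).2 ⟨s, hs, ?_⟩
  -- A computation halting only after `s` would halt at a settled stage, hence be exceptional and
  -- halt by `M ≤ s`.
  have key : ((Denumerable.ofNat Nat.Partrec.Code e).eval e).Dom ↔ haltsWithin e s = true := by
    rw [dom_iff_exists_haltsWithin]
    refine ⟨fun h => ?_, fun h => ⟨s, h⟩⟩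
    by_contra hns
    refine hns (haltsWithin_mono hsM (hM e ⟨Nat.find h, Nat.find_spec h, fun t ht => ?_, ?_⟩))
    · simpa using Nat.find_min h ht
    · refine hstab e s _ hs₀ ?_ hAs
      by_contra hlt
      exact hns (haltsWithin_mono (le_of_not_ge hlt) (Nat.find_spec h))
  by_cases h : haltsWithin e s = true
  · rw [if_pos (key.2 h), h]; rfl
  · rw [if_neg (mt key.1 h), Bool.eq_false_of_not_eq_true h]; rfl

section

variable {U : BinStr → BinStr →. BinStr}

theorem computable_of_program (hU : IsUniversalOptimal U) {P : BinStr} {q : ℕ → ℕ}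
    (hq : ∀ s, strOfNat (q s) ∈ U (strOfNat s) P) : Computable q := by
  have h : Partrec fun s : ℕ => (U (strOfNat s) P).map natOfStr :=
    (hU.partrec.comp computable_strOfNat (Computable.const P)).map
      (computable_natOfStr.comp Computable.snd)
  exact h.of_eq_tot fun s => (Part.mem_map_iff _).2 ⟨_, hq s, natOfStr_strOfNat _⟩

theorem exists_enumerates (hU : IsUniversalOptimal U) {α : ℝ} (hα : IsLeftCE α) :
    ∃ P, Enumerates U P α := by
  obtain ⟨q, hq, hqα⟩ := hα
  obtain ⟨P, hP⟩ := hU.universal (fun y => Part.some (strOfNat (q (natOfStr y))))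
    (computable_strOfNat.comp (hq.comp computable_natOfStr))
  exact ⟨P, q, fun s => by rw [hP, natOfStr_strOfNat]; exact Part.mem_some _, hqα⟩

/-- The machine that, from `1ˡ0PQ` with `l(P) = l`, computes the number `n` with program `Q`, waits
until the `n`-th program halts on `n`, and outputs the first `n` digits of the rational that `P`
computes from the number of steps. -/
noncomputable def haltingClockMachine (U : BinStr → BinStr →. BinStr) : BinStr →. BinStr := fun R =>
  (U [] ((unaryRest R).drop (unaryLen R))).bind fun x =>
    (Nat.rfind fun s => Part.some (haltsWithin (natOfStr x) s)).bind fun s =>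
      (U (strOfNat s) ((unaryRest R).take (unaryLen R))).map fun y =>
        initSeg ((ratOfNat (natOfStr y) : ℚ) : ℝ) (natOfStr x)

theorem partrec_haltingClockMachine (hU : IsUniversalOptimal U) :
    Partrec (haltingClockMachine U) := by
  refine Partrec.bind (hU.partrec.comp (Computable.const _) (Primrec.list_drop.to_comp.comp
    computable_unaryLen computable_unaryRest)) ?_
  refine Partrec.bind (Partrec.rfind ?_) ?_
  · exact primrec_haltsWithin.to_comp.comp (computable_natOfStr.comp
      (Computable.snd.comp Computable.fst)) Computable.snd
  · refine Partrec.map (hU.partrec.comp (computable_strOfNat.comp Computable.snd)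
      ((Primrec.list_take.to_comp.comp computable_unaryLen computable_unaryRest).comp
        (Computable.fst.comp Computable.fst))) ?_
    exact primrec_initSeg_ratOfNat.to_comp.comp (computable_natOfStr.comp Computable.snd)
      (computable_natOfStr.comp (Computable.snd.comp (Computable.fst.comp Computable.fst)))

theorem exists_infinite_C_initSeg_lt (hU : IsUniversalOptimal U) :
    ∃ c, ∀ α : ℝ, ¬ IsComputableReal α → ¬ IsTuringComplete α → ∀ P, Enumerates U P α →
      {n | C U (initSeg α n) < CNat U n + (2 * P.length + c)}.Infinite := by
  obtain ⟨c, hc⟩ := hU.exists_C_le (partrec_haltingClockMachine hU)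
  -- One unit pays for the separating zero, the other for strictness.
  refine ⟨c + 2, fun α hα hα' P ⟨q, hq, hqα⟩ => ?_⟩
  obtain ⟨s₀, hlim, hstab⟩ := exists_stage_initSeg_stable hα hqα
  refine (infinite_settled_at_halting hα' (A := fun s n => initSeg ((ratOfNat (q s) : ℚ) : ℝ) n)
    (primrec_initSeg_ratOfNat.to_comp.comp ((computable_of_program hU hq).comp Computable.fst)
      Computable.snd) hlim hstab).mono ?_
  rintro n ⟨s, hs, hmin, hn⟩
  obtain ⟨Q, hQ, hQn⟩ := hU.exists_minimal_program (strOfNat n)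
  have hmem : initSeg α n ∈ haltingClockMachine U
      (List.replicate P.length true ++ false :: (P ++ Q)) := by
    simp only [haltingClockMachine, unaryLen_replicate, unaryRest_replicate, List.drop_left,
      List.take_left]
    refine Part.mem_bind hQn ?_
    rw [natOfStr_strOfNat]
    refine Part.mem_bind (a := s) ?_ ?_
    · refine Nat.mem_rfind.2 ⟨by simp [hs], fun {t} ht => by simp [hmin t ht]⟩
    · refine (Part.mem_map_iff _).2 ⟨_, hq s, ?_⟩
      rw [natOfStr_strOfNat, hn]
  have h := hc _ _ hmem
  simp only [List.length_append, List.length_replicate, List.length_cons] at h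
  change C U (initSeg α n) < C U (strOfNat n) + (2 * P.length + (c + 2))
  omega

end

/-! ### Unboundedness of the complexity of initial segments -/

section

variable {U : BinStr → BinStr →. BinStr}

theorem length_strOfNat_le {n m : ℕ} (h : n + 1 < 2 ^ (m + 1)) : (strOfNat n).length ≤ m := by
  have h1 := (natOfStr_bounds (strOfNat n)).1
  rw [natOfStr_strOfNat] at h1
  exact Nat.lt_succ_iff.1 ((Nat.pow_lt_pow_iff_right one_lt_two).1 (h1.trans_lt h))

theorem length_strOfNat {j m : ℕ} (h : j < 2 ^ m) : (strOfNat (2 ^ m - 1 + j)).length = m := by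
  have h0 : 1 ≤ 2 ^ m := Nat.one_le_two_pow
  refine le_antisymm (length_strOfNat_le (by rw [pow_succ]; omega)) ?_
  have h1 := (natOfStr_bounds (strOfNat (2 ^ m - 1 + j))).2
  rw [natOfStr_strOfNat] at h1
  exact Nat.lt_succ_iff.1 ((Nat.pow_lt_pow_iff_right one_lt_two).1 (lt_of_le_of_lt (by omega) h1))

/-- Among the `2 ^ m` numbers whose strings have length `m` there is an incompressible one. -/
theorem IsUniversalOptimal.exists_incompressible (hU : IsUniversalOptimal U) (m : ℕ) :
    ∃ j < 2 ^ m, m ≤ CNat U (2 ^ m - 1 + j) := by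
  by_contra! hcon
  choose P hPlen hP using fun j => hU.exists_minimal_program (strOfNat (2 ^ m - 1 + j))
  have hmaps : ∀ j ∈ Finset.range (2 ^ m), natOfStr (P j) ∈ Finset.range (2 ^ m - 1) := by
    intro j hj
    rw [Finset.mem_range] at hj ⊢
    have h1 : (P j).length + 1 ≤ m := by rw [hPlen]; exact hcon j hj
    have h2 := (natOfStr_bounds (P j)).2
    have h3 : 2 ^ ((P j).length + 1) ≤ 2 ^ m := Nat.pow_le_pow_right two_pos h1
    omega
  have hcard : (Finset.range (2 ^ m - 1)).card < (Finset.range (2 ^ m)).card := by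
    have : 0 < 2 ^ m := by positivity
    simp only [Finset.card_range]
    omega
  obtain ⟨i, -, j, -, hij, heq⟩ := Finset.exists_ne_map_eq_of_card_lt_of_maps_to hcard hmaps
  apply hij
  have hPij : P i = P j := by rw [← strOfNat_natOfStr (P i), heq, strOfNat_natOfStr]
  have h := congrArg natOfStr (Part.mem_unique (hP i) (hPij ▸ hP j))
  rw [natOfStr_strOfNat, natOfStr_strOfNat] at h
  omega

/-- At stage `t`, at least `B` of the first `L` programs have output a string of length `n`. -/
def manyOfLength (u : ℕ → ℕ → Option BinStr) (B L t n : ℕ) : Bool :=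
  decide (B ≤ Nat.count (fun k => decide ((u t k).map List.length = some n) = true) L)

/-- `p = ⟨t, n⟩`, where `t` is the first stage at which `manyOfLength u B L t n` holds. -/
def firstManyOfLength (u : ℕ → ℕ → Option BinStr) (B L p : ℕ) : Bool :=
  manyOfLength u B L p.unpair.1 p.unpair.2 &&
    decide (∀ t < p.unpair.1, (!manyOfLength u B L t p.unpair.2) = true)

theorem computable_manyOfLength {u : ℕ → ℕ → Option BinStr} (hu : Computable₂ u) :
    Computable fun y : (ℕ × ℕ) × (ℕ × ℕ) => manyOfLength u y.1.1 y.1.2 y.2.1 y.2.2 := by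
  have hc : Computable₂ fun (y : ℕ × ℕ) (k : ℕ) =>
      decide ((u y.1 k).map List.length = some y.2) :=
    computable_decide_eq (Computable.option_map (hu.comp (Computable.fst.comp Computable.fst)
      Computable.snd) (Computable.list_length.comp Computable.snd).to₂)
        (Computable.option_some.comp (Computable.snd.comp Computable.fst))
  exact computable_decide_le (Computable.fst.comp Computable.fst)
    ((computable_count hc).comp Computable.snd (Computable.snd.comp Computable.fst))

theorem computable_firstManyOfLength {u : ℕ → ℕ → Option BinStr} (hu : Computable₂ u) :
    Computable fun x : (ℕ × ℕ) × ℕ => firstManyOfLength u x.1.1 x.1.2 x.2 := by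
  have hg : Computable fun x : ((ℕ × ℕ) × ℕ) × ℕ => (x.1.1, (x.2, x.1.2.unpair.2)) :=
    (Computable.fst.comp Computable.fst).pair (Computable.snd.pair (Computable.snd.comp
      (Computable.unpair.comp (Computable.snd.comp Computable.fst))))
  have hm := (computable_manyOfLength hu).comp hg
  have ht : Computable fun x : (ℕ × ℕ) × ℕ => x.2.unpair.1 :=
    Computable.fst.comp (Computable.unpair.comp Computable.snd)
  have hnow := (computable_manyOfLength hu).comp
    (Computable.fst.pair (Computable.unpair.comp Computable.snd))
  have hnot : Computable₂ fun (x : (ℕ × ℕ) × ℕ) (t : ℕ) =>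
      !manyOfLength u x.1.1 x.1.2 t x.2.unpair.2 := Primrec.not.to_comp.comp hm
  exact computable_and hnow ((computable_forall_lt hnot).comp Computable.id ht)

/-- There are at most `L / B` lengths that at least `B` of the first `L` programs produce. -/
theorem count_firstManyOfLength_mul_le {u : ℕ → ℕ → Option BinStr}
    (hmono : ∀ s t k x, s ≤ t → u s k = some x → u t k = some x) (B L N : ℕ) :
    Nat.count (fun p => firstManyOfLength u B L p = true) N * B ≤ L := by
  rw [Nat.count_eq_card_filter_range]
  set S := (Finset.range N).filter fun p => firstManyOfLength u B L p = true with hS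
  -- Each popular length is charged to the programs producing strings of that length. A program has
  -- only one output, so these sets are disjoint.
  let T : ℕ → Finset ℕ := fun p => (Finset.range L).filter fun k =>
    decide ((u p.unpair.1 k).map List.length = some p.unpair.2) = true
  have hT : ∀ p ∈ S, B ≤ (T p).card := by
    intro p hp
    have := (Finset.mem_filter.1 hp).2
    simp only [firstManyOfLength, manyOfLength, Bool.and_eq_true, decide_eq_true_eq] at this
    simpa only [T, Nat.count_eq_card_filter_range, decide_eq_true_eq] using this.1
  have hinj : ∀ p ∈ S, ∀ p' ∈ S, p.unpair.2 = p'.unpair.2 → p.unpair.1 < p'.unpair.1 → False := by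
    intro p hp p' hp' h hlt
    have h1 := (Finset.mem_filter.1 hp).2
    have h2 := (Finset.mem_filter.1 hp').2
    simp only [firstManyOfLength, Bool.and_eq_true, decide_eq_true_eq] at h1 h2
    have := h2.2 _ hlt
    rw [← h, h1.1] at this
    simp at this
  have hdisj : (S : Set ℕ).PairwiseDisjoint T := by
    intro p hp p' hp' hne
    rw [Function.onFun, Finset.disjoint_left]
    intro k hk hk'
    simp only [T, Finset.mem_filter, decide_eq_true_eq, Option.map_eq_some_iff] at hk hk'
    obtain ⟨-, x, hx, hxl⟩ := hk
    obtain ⟨-, x', hx', hxl'⟩ := hk'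
    have hxx : x = x' := by
      rcases le_total p.unpair.1 p'.unpair.1 with h | h
      · exact Option.some_injective _ ((hmono _ _ _ _ h hx).symm.trans hx')
      · exact Option.some_injective _ (hx.symm.trans (hmono _ _ _ _ h hx'))
    have h2 : p.unpair.2 = p'.unpair.2 := by rw [← hxl, ← hxl', hxx]
    rcases lt_trichotomy p.unpair.1 p'.unpair.1 with h | h | h
    · exact hinj p hp p' hp' h2 h
    · exact hne (by rw [← Nat.pair_unpair p, ← Nat.pair_unpair p', h, h2])
    · exact hinj p' hp' p hp h2.symm h
  calc S.card * B ≤ ∑ p ∈ S, (T p).card := by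
        simpa using Finset.card_nsmul_le_sum S (fun p => (T p).card) B hT
    _ = (S.biUnion T).card := (Finset.card_biUnion hdisj).symm
    _ ≤ (Finset.range L).card := Finset.card_le_card (Finset.biUnion_subset.2 fun p _ =>
        Finset.filter_subset _ _)
    _ = L := Finset.card_range L

/-- The machine that, from `1ᵃ0z`, puts `m = l(z) + 2a` and outputs the number `n` such that the
index of `n` among the lengths produced by at least `2 ^ (2a + c)` of the first `2 ^ (m + c)`
programs is given by `z`. -/
def popularLengthMachine (u : ℕ → ℕ → Option BinStr) (c : ℕ) : BinStr →. BinStr := fun R =>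
  let B := 2 ^ (2 * unaryLen R + c)
  let L := 2 ^ ((unaryRest R).length + 2 * unaryLen R + c)
  (Nat.rfind fun p => Part.some (firstManyOfLength u B L p &&
    decide (2 ^ (unaryRest R).length - 1 +
      Nat.count (fun p => firstManyOfLength u B L p = true) p = natOfStr (unaryRest R)))).map
        fun p => strOfNat p.unpair.2

theorem partrec_popularLengthMachine {u : ℕ → ℕ → Option BinStr} (hu : Computable₂ u) (c : ℕ) :
    Partrec (popularLengthMachine u c) := by
  have hpow : Computable fun n : ℕ => 2 ^ n :=
    (primrec_pow.comp (Primrec.const 2) Primrec.id).to_comp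
  have hlen : Computable fun R : BinStr => (unaryRest R).length :=
    Computable.list_length.comp computable_unaryRest
  have hdbl : Computable fun R : BinStr => 2 * unaryLen R :=
    Primrec.nat_double.to_comp.comp computable_unaryLen
  have hadd := Primrec.nat_add.to_comp
  have hB : Computable fun R : BinStr => 2 ^ (2 * unaryLen R + c) :=
    hpow.comp (hadd.comp hdbl (Computable.const c))
  have hL : Computable fun R : BinStr => 2 ^ ((unaryRest R).length + 2 * unaryLen R + c) :=
    hpow.comp (hadd.comp (hadd.comp hlen hdbl) (Computable.const c))
  have hf : Computable₂ fun (R : BinStr) (p : ℕ) => firstManyOfLength u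
      (2 ^ (2 * unaryLen R + c)) (2 ^ ((unaryRest R).length + 2 * unaryLen R + c)) p :=
    (computable_firstManyOfLength hu).comp
      (((hB.comp Computable.fst).pair (hL.comp Computable.fst)).pair Computable.snd)
  refine Partrec.map (Partrec.rfind (computable_and hf (computable_decide_eq (hadd.comp
    (Primrec.nat_sub.to_comp.comp (hpow.comp (hlen.comp Computable.fst)) (Computable.const 1))
      (computable_count hf)) (computable_natOfStr.comp
        (computable_unaryRest.comp Computable.fst))))) ?_
  exact computable_strOfNat.comp (Computable.snd.comp (Computable.unpair.comp Computable.snd))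

/-- For an incompressible `n`, the number of strings of length `n` whose complexity exceeds that
of `n` by at most a constant is bounded. -/
theorem exists_card_le_of_incompressible (hU : IsUniversalOptimal U) (c : ℕ) :
    ∃ b m₀, ∀ m n, m₀ ≤ m → m ≤ CNat U n → ∀ X : Finset BinStr,
      (∀ x ∈ X, x.length = n ∧ ∃ k < 2 ^ (m + c), x ∈ U [] (strOfNat k)) → X.card ≤ b := by
  obtain ⟨u, hu, hmono, hmem⟩ := exists_stages (f := fun k : ℕ => U [] (strOfNat k))
    (hU.partrec.comp (Computable.const _) computable_strOfNat)
  obtain ⟨d, hd⟩ := hU.exists_C_le (partrec_popularLengthMachine hu c)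
  -- The description of `n` will have length `a + 1 + (m - 2 * a)`; with the overhead `d` this is `m
  -- - 1`, one less than incompressibility allows.
  obtain ⟨a, ha⟩ : ∃ a, a = d + 2 := ⟨_, rfl⟩
  refine ⟨2 ^ (2 * a + c), 2 * a, fun m n hm hn X hX => ?_⟩
  by_contra! hcard
  choose! k hkL hk using fun x hx => (hX x hx).2
  set B := 2 ^ (2 * a + c) with hB
  set L := 2 ^ (m + c) with hL
  have hmany : ∃ t, manyOfLength u B L t n = true := by
    have : ∀ x ∈ X, ∀ᶠ t in Filter.atTop, u t (k x) = some x := by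
      intro x hx
      obtain ⟨t, ht⟩ := (hmem _ _).1 (hk x hx)
      filter_upwards [Filter.eventually_ge_atTop t] with t' h' using hmono _ _ _ _ h' ht
    obtain ⟨t, ht⟩ := ((Filter.eventually_all_finset X).2 this).exists
    refine ⟨t, ?_⟩
    rw [manyOfLength, decide_eq_true_eq, Nat.count_eq_card_filter_range]
    refine hcard.le.trans (Finset.card_le_card_of_injOn k (fun x hx => ?_) fun x hx y hy hxy => ?_)
    · simpa [ht x hx, (hX x hx).1] using hkL x hx
    · exact Option.some_injective _ ((ht x hx).symm.trans (hxy ▸ ht y hy))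
  obtain ⟨p, hp⟩ : ∃ p, p = Nat.pair (Nat.find hmany) n := ⟨_, rfl⟩
  have hpn : p.unpair.2 = n := by rw [hp, Nat.unpair_pair]
  have hfirst : firstManyOfLength u B L p = true := by
    simp only [firstManyOfLength, hp, Nat.unpair_pair, Bool.and_eq_true, decide_eq_true_eq]
    exact ⟨Nat.find_spec hmany, fun t ht => by simpa using Nat.find_min hmany ht⟩
  obtain ⟨i, hi⟩ : ∃ i, i = Nat.count (fun p => firstManyOfLength u B L p = true) p := ⟨_, rfl⟩
  -- Counting up to `p + 1` includes `p` itself, which makes the bound on the index strict. The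
  -- index thus fits in `m - 2 * a` bits, and padding it to exactly that length lets the machine
  -- recover `m`.
  have hiL : i < 2 ^ (m - 2 * a) := by
    have h := count_firstManyOfLength_mul_le hmono B L (p + 1)
    rw [Nat.count_succ, if_pos hfirst, ← hi, hL, show m + c = (m - 2 * a) + (2 * a + c) by omega,
      pow_add] at h
    exact Nat.le_of_mul_le_mul_right h (by positivity)
  have hz := length_strOfNat hiL
  set z := strOfNat (2 ^ (m - 2 * a) - 1 + i) with hzdef
  have hout : strOfNat n ∈ popularLengthMachine u c (List.replicate a true ++ false :: z) := by
    simp only [popularLengthMachine, unaryLen_replicate, unaryRest_replicate, hz]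
    rw [show m - 2 * a + 2 * a + c = m + c by omega, ← hB, ← hL, hzdef, natOfStr_strOfNat]
    refine (Part.mem_map_iff _).2 ⟨p, Nat.mem_rfind.2 ⟨?_, fun {p'} hp' => ?_⟩, by rw [hpn]⟩
    · simp [hfirst, hi]
    · have hne : ¬ (firstManyOfLength u B L p' = true ∧
          Nat.count (fun p => firstManyOfLength u B L p = true) p' = i) := by
        rintro ⟨h1, h2⟩
        exact hp'.ne (Nat.count_injective h1 hfirst (h2.trans hi))
      rw [Part.mem_some_iff, eq_comm, Bool.eq_false_iff]
      simpa using hne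
  have h := hd _ _ hout
  simp only [List.length_append, List.length_replicate, List.length_cons, hz] at h
  have : CNat U n ≤ a + (m - 2 * a + 1) + d := h
  omega

end

/-- An eventually bounded sequence of natural numbers attains its upper limit infinitely often. -/
theorem exists_eq_limsup {f : ℕ → ℕ} {b m₀ : ℕ} (h : ∀ m, m₀ ≤ m → f m ≤ b) :
    ∃ w M, (∀ m, M ≤ m → f m ≤ w) ∧ ∀ i, ∃ m, i ≤ m ∧ f m = w := by
  classical
  have hex : ∃ w M, ∀ m, M ≤ m → f m ≤ w := ⟨b, m₀, h⟩
  obtain ⟨M, hM⟩ := Nat.find_spec hex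
  refine ⟨Nat.find hex, M, hM, fun i => ?_⟩
  by_contra! hcon
  rcases Nat.eq_zero_or_pos (Nat.find hex) with h0 | hpos
  · have := hM (max i M) (le_max_right _ _)
    exact hcon _ (le_max_left i M) (by omega)
  · refine Nat.find_min hex (Nat.sub_one_lt hpos.ne') ⟨max i M, fun m hm => ?_⟩
    have h1 := hM m ((le_max_right _ _).trans hm)
    have h2 := hcon m ((le_max_left _ _).trans hm)
    omega

/-- If the approximations to the first `2 ^ m - 1` digits of `α` are revised at a bounded number of
computably recognizable stages, the last of which is correct, then `α` is computable. -/
theorem isComputableReal_of_bounded_revisions {α : ℝ} {A : ℕ → ℕ → BinStr} (hA : Computable₂ A)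
    {r : ℕ → ℕ → Bool} (hr : Computable₂ r) {b m₀ : ℕ}
    (hb : ∀ m, m₀ ≤ m → ∀ S : Finset ℕ, (∀ s ∈ S, r m s = true) → S.card ≤ b)
    (hlast : ∀ m, ∃ s, r m s = true ∧ (∀ t, s < t → r m t = false) ∧
      A s (2 ^ m - 1) = initSeg α (2 ^ m - 1)) :
    IsComputableReal α := by
  choose l hl hlmax hlA using hlast
  let cnt : ℕ → ℕ → ℕ := fun m s => Nat.count (fun i => r m i = true) s
  have hcnt : Computable₂ cnt := computable_count hr
  obtain ⟨w, M, hM, hw⟩ := exists_eq_limsup (f := fun m => cnt m (l m + 1)) (b := b) (m₀ := m₀) (by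
    -- The distinct revision stages up to the last one form a finite set to which the bound applies.
    intro m hm
    simp only [cnt, Nat.count_eq_card_filter_range]
    exact hb m hm _ fun s hs => (Finset.mem_filter.1 hs).2)
  -- For `m ≥ M` there are at most `w` revisions, so the `w`-th is the last and can be recognized
  -- when it occurs.
  have huniq : ∀ m s, M ≤ m → r m s = true → cnt m (s + 1) = w → s = l m := by
    intro m s hm hs hsw
    rcases lt_trichotomy s (l m) with h | h | h
    · have h1 : cnt m (l m + 1) = cnt m (l m) + 1 := by simp [cnt, Nat.count_succ, hl]
      have h2 : cnt m (s + 1) ≤ cnt m (l m) := Nat.count_monotone _ h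
      have h3 : cnt m (l m + 1) ≤ w := hM m hm
      omega
    · exact h
    · rw [hlmax m s h] at hs
      cases hs
  let test : ℕ → ℕ → Bool := fun i p => decide (max M (i + 1) ≤ p.unpair.1) &&
    (r p.unpair.1 p.unpair.2 && decide (cnt p.unpair.1 (p.unpair.2 + 1) = w))
  have h1 : Computable fun x : ℕ × ℕ => x.2.unpair.1 :=
    Computable.fst.comp (Computable.unpair.comp Computable.snd)
  have h2 : Computable fun x : ℕ × ℕ => x.2.unpair.2 :=
    Computable.snd.comp (Computable.unpair.comp Computable.snd)
  have htest : Computable₂ test :=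
    computable_and (computable_decide_le (Primrec.nat_max.to_comp.comp (Computable.const M)
      (Computable.succ.comp Computable.fst)) h1) (computable_and (hr.comp h1 h2)
        (computable_decide_eq (hcnt.comp h1 (Computable.succ.comp h2)) (Computable.const w)))
  have hcomp : Partrec fun i => (Nat.rfind fun p => Part.some (test i p)).map fun p =>
      ((A p.unpair.2 (2 ^ p.unpair.1 - 1))[i]?).getD false := by
    refine Partrec.map (Partrec.rfind htest) ?_
    refine Computable.option_getD (Computable.list_getElem?.comp (hA.comp h2 ?_) Computable.fst)
      (Computable.const false)
    exact Primrec.nat_sub.to_comp.comp (primrec_pow.to_comp.comp (Computable.const 2) h1)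
      (Computable.const 1)
  refine hcomp.of_eq_tot fun i => ?_
  obtain ⟨m, hm, hmw⟩ := hw (max M (i + 1))
  obtain ⟨p, hp, -⟩ := Nat.rfind_min' (p := test i) (m := Nat.pair m (l m)) (by
    simp only [test, Nat.unpair_pair, Bool.and_eq_true, decide_eq_true_eq]
    exact ⟨hm, hl m, hmw⟩)
  have hspec := Nat.rfind_spec hp
  simp only [PFun.coe_val, Part.mem_some_iff, eq_comm (a := true), test, Bool.and_eq_true,
    decide_eq_true_eq, max_le_iff] at hspec
  obtain ⟨⟨hpM, hpi⟩, hpr, hpw⟩ := hspec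
  refine (Part.mem_map_iff _).2 ⟨p, hp, ?_⟩
  -- Since `i + 1 ≤ m < 2 ^ m`, digit `i` lies within the first `2 ^ m - 1` and the default value is
  -- never used.
  have hlt : p.unpair.1 < 2 ^ p.unpair.1 := Nat.lt_two_pow_self
  rw [huniq _ _ hpM hpr hpw, hlA, getElem?_initSeg α (by omega), Option.getD_some]

/-- A left c.e. real whose initial segments have, up to a constant, the complexity of their
lengths is computable. -/
theorem isComputableReal_of_C_le {U : BinStr → BinStr →. BinStr} (hU : IsUniversalOptimal U)
    {α : ℝ} (hα : IsLeftCE α) {k : ℕ} (hk : ∀ n, C U (initSeg α n) ≤ CNat U n + k) :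
    IsComputableReal α := by
  by_contra hnc
  obtain ⟨q, hq, hqα⟩ := hα
  obtain ⟨s₀, hlim, hstab⟩ := exists_stage_initSeg_stable hnc hqα
  let A : ℕ → ℕ → BinStr := fun s n => initSeg ((ratOfNat (q (s₀ + s)) : ℚ) : ℝ) n
  have hA : Computable₂ A := primrec_initSeg_ratOfNat.to_comp.comp (hq.comp
    (Primrec.nat_add.to_comp.comp (Computable.const s₀) Computable.fst)) Computable.snd
  have hAstab : ∀ n s t, s ≤ t → A s n = initSeg α n → A t n = initSeg α n := fun n s t hst h =>
    hstab n _ _ (Nat.le_add_right _ _) (Nat.add_le_add_left hst _) h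
  have hAlim : ∀ n, ∀ᶠ s in Filter.atTop, A s n = initSeg α n := by
    intro n
    obtain ⟨s, hs, h⟩ := hlim n
    filter_upwards [Filter.eventually_ge_atTop (s - s₀)] with t ht
    exact hstab n s _ hs (by omega) h
  obtain ⟨c₀, hc₀⟩ := hU.exists_C_le_length
  -- The extra `1` turns a bound on the length of a program into a bound on its index.
  obtain ⟨c, hc⟩ : ∃ c, c = c₀ + k + 1 := ⟨_, rfl⟩
  obtain ⟨u, hu, hmono, hmem⟩ := exists_stages (f := fun k : ℕ => U [] (strOfNat k))
    (hU.partrec.comp (Computable.const _) computable_strOfNat)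
  -- At a good stage the current approximations of all lengths in the `m`-th block have short
  -- programs. A revision `r` is a good stage whose first `2 ^ m - 1` digits occurred at no earlier
  -- good stage.
  let good : ℕ → ℕ → Bool := fun m s => decide (∀ j < 2 ^ m,
    decide (∃ i < 2 ^ (m + c), decide (u s i = some (A s (2 ^ m - 1 + j))) = true) = true)
  let r : ℕ → ℕ → Bool := fun m s => good m s && decide (∀ t < s,
    (!(good m t && decide (A t (2 ^ m - 1) = A s (2 ^ m - 1)))) = true)
  have hpow : Computable fun n : ℕ => 2 ^ n :=
    (primrec_pow.comp (Primrec.const 2) Primrec.id).to_comp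
  have hlow : Computable fun m : ℕ => 2 ^ m - 1 :=
    Primrec.nat_sub.to_comp.comp hpow (Computable.const 1)
  have hgood : Computable₂ good := by
    have h1 : Computable₂ fun (x : (ℕ × ℕ) × ℕ) (i : ℕ) =>
        decide (u x.1.2 i = some (A x.1.2 (2 ^ x.1.1 - 1 + x.2))) := by
      have hs : Computable fun y : ((ℕ × ℕ) × ℕ) × ℕ => y.1.1.2 :=
        Computable.snd.comp (Computable.fst.comp Computable.fst)
      refine computable_decide_eq (hu.comp hs Computable.snd) (Computable.option_some.comp
        (hA.comp hs (Primrec.nat_add.to_comp.comp (hlow.comp (Computable.fst.comp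
          (Computable.fst.comp Computable.fst))) (Computable.snd.comp Computable.fst))))
    have h2 : Computable₂ fun (x : ℕ × ℕ) (j : ℕ) => decide (∃ i < 2 ^ (x.1 + c),
        decide (u x.2 i = some (A x.2 (2 ^ x.1 - 1 + j))) = true) :=
      (computable_exists_lt h1).comp Computable.id (hpow.comp (Primrec.nat_add.to_comp.comp
        (Computable.fst.comp Computable.fst) (Computable.const c)))
    exact (computable_forall_lt h2).comp Computable.id (hpow.comp Computable.fst)
  have hr : Computable₂ r := by
    have h1 : Computable₂ fun (x : ℕ × ℕ) (t : ℕ) =>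
        !(good x.1 t && decide (A t (2 ^ x.1 - 1) = A x.2 (2 ^ x.1 - 1))) := by
      have hm : Computable fun y : (ℕ × ℕ) × ℕ => y.1.1 := Computable.fst.comp Computable.fst
      exact Primrec.not.to_comp.comp (computable_and (hgood.comp hm Computable.snd)
        (computable_decide_eq (hA.comp Computable.snd (hlow.comp hm))
          (hA.comp (Computable.snd.comp Computable.fst) (hlow.comp hm))))
    exact computable_and hgood ((computable_forall_lt h1).comp Computable.id Computable.snd)
  have hgood_iff : ∀ m s, good m s = true ↔ ∀ j < 2 ^ m, ∃ i < 2 ^ (m + c),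
      u s i = some (A s (2 ^ m - 1 + j)) := by
    intro m s
    simp only [good, decide_eq_true_eq]
  have hr_iff : ∀ m s, r m s = true ↔ good m s = true ∧ ∀ t < s, good m t = true →
      A t (2 ^ m - 1) ≠ A s (2 ^ m - 1) := by
    intro m s
    simp only [r, Bool.and_eq_true, decide_eq_true_eq, Bool.not_eq_true', Bool.and_eq_false_imp,
      decide_eq_false_iff_not, ne_eq]
  obtain ⟨b, m₀, hb⟩ := exists_card_le_of_incompressible hU c
  refine hnc (isComputableReal_of_bounded_revisions hA hr (b := b) (m₀ := m₀) ?_ ?_)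
  · intro m hm S hS
    obtain ⟨j, hj, hjm⟩ := hU.exists_incompressible m
    -- The incompressible length is at least `2 ^ m - 1`, so equal segments of that length would
    -- repeat the digits that a revision must make new.
    have hinj : Set.InjOn (fun s => A s (2 ^ m - 1 + j)) S := by
      have key : ∀ s ∈ S, ∀ t ∈ S, A s (2 ^ m - 1 + j) = A t (2 ^ m - 1 + j) → ¬ s < t := by
        intro s hs t ht h hlt
        refine ((hr_iff m t).1 (hS t ht)).2 s hlt ((hr_iff m s).1 (hS s hs)).1 ?_
        have := congrArg (List.take (2 ^ m - 1)) h
        simpa only [A, take_initSeg _ (Nat.le_add_right (2 ^ m - 1) j)] using this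
      intro s hs t ht h
      exact le_antisymm (not_lt.1 (key t ht s hs h.symm)) (not_lt.1 (key s hs t ht h))
    rw [← Finset.card_image_of_injOn hinj]
    refine hb m _ hm hjm _ fun x hx => ?_
    obtain ⟨s, hs, rfl⟩ := Finset.mem_image.1 hx
    obtain ⟨i, hi, hui⟩ := (hgood_iff m s).1 ((hr_iff m s).1 (hS s hs)).1 j hj
    exact ⟨length_initSeg _ _, i, hi, (hmem _ _).2 ⟨s, hui⟩⟩
  · intro m
    have hprog : ∀ j ∈ Finset.range (2 ^ m), ∀ᶠ s in Filter.atTop, ∃ i < 2 ^ (m + c),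
        u s i = some (A s (2 ^ m - 1 + j)) := by
      intro j hj
      have hj := Finset.mem_range.1 hj
      obtain ⟨P, hPlen, hP⟩ := hU.exists_minimal_program (initSeg α (2 ^ m - 1 + j))
      obtain ⟨t, ht⟩ := (hmem (natOfStr P) (initSeg α (2 ^ m - 1 + j))).1
        (by rwa [strOfNat_natOfStr])
      filter_upwards [Filter.eventually_ge_atTop t, hAlim (2 ^ m - 1 + j)] with s hs hAs
      refine ⟨natOfStr P, ?_, by rw [hAs]; exact hmono _ _ _ _ hs ht⟩
      have h1 := hk (2 ^ m - 1 + j)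
      have h2 := hc₀ (strOfNat (2 ^ m - 1 + j))
      rw [length_strOfNat hj] at h2
      have h3 : P.length + 1 ≤ m + c := by
        rw [CNat] at h1
        omega
      exact (Nat.lt_succ_self _).trans ((natOfStr_bounds P).2.trans_le
        (Nat.pow_le_pow_right two_pos h3))
    -- The first good stage with correct digits is a revision, and it is the last one because
    -- correct digits never change afterwards.
    have hex : ∃ s, good m s = true ∧ A s (2 ^ m - 1) = initSeg α (2 ^ m - 1) := by
      obtain ⟨s, hs, hAs⟩ := (((Filter.eventually_all_finset _).2 hprog).and
        (hAlim (2 ^ m - 1))).exists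
      exact ⟨s, (hgood_iff m s).2 fun j hj => hs j (Finset.mem_range.2 hj), hAs⟩
    obtain ⟨hg, hAs⟩ := Nat.find_spec hex
    refine ⟨Nat.find hex, (hr_iff _ _).2 ⟨hg, fun t ht hgt h => ?_⟩, fun t ht => ?_, hAs⟩
    · exact Nat.find_min hex ht ⟨hgt, h.trans hAs⟩
    · rw [Bool.eq_false_iff]
      intro hrt
      exact ((hr_iff _ _).1 hrt).2 _ ht hg (hAs.trans (hAstab _ _ _ ht.le hAs).symm)

end LeftCE

theorem mainTheorem5 (U : LeftCE.BinStr → LeftCE.BinStr →. LeftCE.BinStr)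
    (hU : LeftCE.IsUniversalOptimal U) :
    ∃ D : ℕ → ℕ, Computable D ∧
      ∀ α : ℝ, LeftCE.IsLeftCE α → ¬ LeftCE.IsComputableReal α → ¬ LeftCE.IsTuringComplete α →
        (∀ k : ℕ, ∃ n : ℕ, LeftCE.CNat U n + k < LeftCE.C U (LeftCE.initSeg α n)) ∧
        (∃ P : LeftCE.BinStr, LeftCE.Enumerates U P α) ∧
        (∀ P : LeftCE.BinStr, LeftCE.Enumerates U P α →
          {n : ℕ | LeftCE.C U (LeftCE.initSeg α n) < LeftCE.CNat U n + D P.length}.Infinite) := by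
  obtain ⟨c, hc⟩ := LeftCE.exists_infinite_C_initSeg_lt hU
  refine ⟨fun l => 2 * l + c, (Primrec.nat_add.comp Primrec.nat_double
    (Primrec.const c)).to_comp, fun α hα hnc hnt => ⟨fun k => ?_,
      LeftCE.exists_enumerates hU hα, fun P hP => hc α hnc hnt P hP⟩⟩
  by_contra! hcon
  exact hnc (LeftCE.isComputableReal_of_C_le hU hα hcon)
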